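/- For integers $k,n,l,m$ write $[k]=\{1,\dots,k\}$, and let $[k]^n$ be the set of words of length $n$ over $[k]$. For a set $\Pi\subseteq[l]^m$ of patterns and a word $\sigma\in[k]^n$, let $\nu(\Pi,\sigma)$ be the number of subsequences of length $m$ of $\sigma$ (counted by their positions) that are order-isomorphic to some $\pi\in\Pi$, and for $n\ge m$ put $$\delta(\Pi,k,n)=\frac{\max\{\nu(\Pi,\sigma) : \sigma\in[k]^n\}}{\binom{n}{m}} .$$ The packing density $\delta(\Pi)$ is the common value of the iterated limits $\lim_{n\to\infty}\lim_{k\to\infty}\delta(\Pi,k,n)$ and $\lim_{k\to\infty}\lim_{n\to\infty}\delta(\Pi,k,n)$. For positive integers $p,q$, let $[p,q]$ denote the layered permutation $p\,(p-1)\cdots 1\,(p+q)\,(p+q-1)\cdots(p+1)$ of $\{1,\dots,p+q\}$, with two layers (maximal decreasing runs of consecutive values) of lengths $p$ and $q$. Corollary. Let $a,b$ be integers with $b>a\ge 2$. Then both iterated limits exist and agree for $\Pi=\{[a,b],[b,a]\}$, and $$\delta([a,b],[b,a])=\binom{a+b}{a}\,\sup_{x\in[0,1]}\bigl(x^a(1-x)^b+x^b(1-x)^a\bigr).$$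 If $b-a\in\{1,2\}$, then the supremum is attained at $x=1/2$. -/

import Mathlib

open Filter Topology

/-- Two words of the same length are order-isomorphic: their letters are ordered in the same way. -/
def OrderIsomorphicWords {m : ℕ} {α β : Type*} [LinearOrder α] [LinearOrder β]
    (u : Fin m → α) (v : Fin m → β) : Prop :=
  ∀ i j : Fin m, u i < u j ↔ v i < v j

/-- The number `ν(Π, σ)` of occurrences in the word `σ ∈ [k]^n` of patterns in `Π ⊆ [l]^m`.
A subsequence is given by its positions, a strictly increasing map `Fin m ↪o Fin n`. -/
noncomputable def occurrences {l m k n : ℕ} (P : Set (Fin m → Fin l)) (σ : Fin n → Fin k) : ℕ :=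
  Set.ncard {e : Fin m ↪o Fin n | ∃ π ∈ P, OrderIsomorphicWords (fun i => σ (e i)) π}

/-- `μ(Π, k, n)`: the maximal number of occurrences of `Π`-patterns in a word of `[k]^n`. -/
noncomputable def maxOccurrences {l m : ℕ} (P : Set (Fin m → Fin l)) (k n : ℕ) : ℕ :=
  Finset.univ.sup fun σ : Fin n → Fin k => occurrences P σ

/-- `δ(Π, k, n) = μ(Π, k, n) / C(n, m)` (meaningful for `n ≥ m`). -/
noncomputable def maxDensity {l m : ℕ} (P : Set (Fin m → Fin l)) (k n : ℕ) : ℝ :=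
  (maxOccurrences P k n : ℝ) / (n.choose m : ℝ)

/-- `d` is the packing density of `Π`: both iterated limits of `δ(Π, k, n)`
(as `k → ∞` and then `n → ∞`, and in the other order) exist and are equal to `d`. -/
def IsPackingDensity {l m : ℕ} (P : Set (Fin m → Fin l)) (d : ℝ) : Prop :=
  (∃ f : ℕ → ℝ, (∀ n, Tendsto (fun k => maxDensity P k n) atTop (𝓝 (f n))) ∧
    Tendsto f atTop (𝓝 d)) ∧
  (∃ g : ℕ → ℝ, (∀ k, Tendsto (fun n => maxDensity P k n) atTop (𝓝 (g k))) ∧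
    Tendsto g atTop (𝓝 d))

/-- The layered permutation `[m₁, …, m_r]` whose layer lengths are the blocks of the composition
`c` of `m`, as a word: consecutive blocks of positions carry consecutive blocks of values, and each
block is reversed. For instance `[2, 3]` is `21543` (here with letters numbered from `0`). -/
def layeredPerm {m : ℕ} (c : Composition m) : Fin m → Fin m :=
  fun i => c.embedding (c.index i) (Fin.rev (c.invEmbedding i))

/-- The composition `m = p + q` into two positive parts. -/
def twoParts (m p q : ℕ) (hp : 0 < p) (hq : 0 < q) (h : p + q = m) : Composition m where
  blocks := [p, q]
  blocks_pos := by
    intro i hi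
    simp only [List.mem_cons, List.not_mem_nil, or_false] at hi
    rcases hi with rfl | rfl <;> assumption
  blocks_sum := by simpa using h

/-! Upper bound. Join two positions of a word when their letters strictly increase from left to
right. Positions in one layer of an occurrence are then nonadjacent and positions in different
layers adjacent, so each occurrence of `[a,b]` or `[b,a]` induces a `K_{a,b}`, and it yields `a! b!`
labelled copies (`ncard_mul_factorial_le`). It remains to bound the density of induced `K_{a,b}` in
an arbitrary graph with weights on its vertices.

Zykov symmetrization (`multipartiteDensity_le_symmetrized`) merges nonadjacent vertices until the
support is a clique, whose vertices stand for the parts of a complete multipartite graph. There the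
density is `(∑ xᵢ^a)(∑ xᵢ^b) - ∑ xᵢ^(a+b)`. At a maximum on the simplex no two positive weights
exist besides a largest one, since the second derivative of a transfer between them is positive
(`not_isLocalMax_transfer`). At most two parts remain, which leaves the one-variable function of the
statement.

Lower bound. Take the two-layer permutation of length `k` with first layer about `t * k`, for a
maximizer `t`, and repeat each letter `N` times. The limits exist because the density increases with
`k` and, by averaging over deleted letters, decreases with `n` (`isPackingDensity_of_bounds`). -/

section Induced

/-! ### Symmetrization of weighted graphs -/

variable {ι κ V W : Type*} [Fintype ι]

/-- The map `h` induces in the graph `Adj` the complete multipartite graph with parts given by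
`side` (the letters of `h` need not be distinct inside a part). -/
def InducesMultipartite (side : ι → κ) (Adj : V → V → Prop) (h : ι → V) : Prop :=
  ∀ i j, Adj (h i) (h j) ↔ side i ≠ side j

open Classical in
/-- The density of the complete multipartite graph given by `side` in the graph `Adj` with vertex
weights `x`. -/
noncomputable def multipartiteDensity [Fintype V] (side : ι → κ) (Adj : V → V → Prop)
    (x : V → ℝ) : ℝ :=
  ∑ h : ι → V, (∏ i, x (h i)) * if InducesMultipartite side Adj h then 1 else 0

-- Change of variables for independent samples: the image under `q` of a sample weighted by `y` is a
-- sample weighted by the pushforward of `y`.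
open Classical in
theorem sum_prod_comp [Fintype V] [Fintype W] (q : W → V) (y : W → ℝ) (G : (ι → V) → ℝ) :
    ∑ h : ι → W, (∏ i, y (h i)) * G (q ∘ h) =
      ∑ h : ι → V, (∏ i, ∑ w with q w = h i, y w) * G h := by
  rw [← Finset.sum_fiberwise Finset.univ (fun h : ι → W => q ∘ h)]
  refine Finset.sum_congr rfl fun h' _ => ?_
  rw [Finset.prod_univ_sum, Finset.sum_mul]
  refine Finset.sum_congr ?_ ?_
  · ext h
    simp [Fintype.mem_piFinset, funext_iff]
  · intro h hh
    have : q ∘ h = h' := by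
      funext i
      simpa using Fintype.mem_piFinset.1 hh i
    rw [this]

-- With independent coordinates of total mass one, all coordinates other than `i₀` integrate out.
open Classical in
theorem sum_prod_marginal [Fintype W] (θ : W → ℝ) (hθ : ∑ c, θ c = 1) (i₀ : ι) (G : W → ℝ) :
    ∑ h : ι → W, (∏ i, θ (h i)) * G (h i₀) = ∑ c, θ c * G c := by
  have h1 : ∀ h : ι → W, (∏ i, θ (h i)) * G (h i₀) =
      ∏ i, (θ (h i) * if i = i₀ then G (h i) else 1) := by
    intro h
    rw [Finset.prod_mul_distrib, Finset.prod_ite_eq' Finset.univ i₀ (fun i => G (h i))]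
    simp
  simp_rw [h1]
  rw [← Fintype.prod_sum (fun i c => θ c * if i = i₀ then G c else 1),
    Finset.prod_eq_single i₀]
  · simp
  · intro i _ hi
    simp [hi, hθ]
  · simp

open Classical in
/-- Weighted Zykov symmetrization: moving the weight of two nonadjacent vertices `u`, `v` to one
of them, chosen at random in proportion to their weights, does not decrease the density. -/
theorem multipartiteDensity_le_symmetrized [Nonempty ι] [Fintype V] (side : ι → κ)
    {Adj : V → V → Prop} (hsymm : ∀ i j, Adj i j → Adj j i) (hirr : ∀ i, ¬ Adj i i)
    {u v : V} (huv : u ≠ v) (hadj : ¬ Adj u v) {x : V → ℝ} (hx : ∀ i, 0 ≤ x i)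
    (hu : 0 < x u) (hv : 0 < x v) :
    multipartiteDensity side Adj x ≤
      x u / (x u + x v) * multipartiteDensity side Adj
          (fun i => if i = u then x u + x v else if i = v then 0 else x i) +
      x v / (x u + x v) * multipartiteDensity side Adj
          (fun i => if i = v then x u + x v else if i = u then 0 else x i) := by
  set s := x u + x v with hs
  have hs0 : 0 < s := by positivity
  set y : V → ℝ := fun i => if i = u then s else if i = v then 0 else x i with hy
  set z : V → ℝ := fun i => if i = v then s else if i = u then 0 else x i with hz
  have hy0 : ∀ i, 0 ≤ y i := by
    intro i
    simp only [hy]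
    split_ifs <;> first | exact hs0.le | exact le_rfl | exact hx i
  let θ : Bool → ℝ := fun c => if c then x u / s else x v / s
  have hθ : ∑ c, θ c = 1 := by
    simp only [θ, Fintype.sum_bool, if_true, Bool.false_eq_true, if_false]
    rw [← add_div, div_self hs0.ne']
  have hθ0 : ∀ c, 0 ≤ θ c := by
    intro c
    cases c <;> simp only [θ, if_true, Bool.false_eq_true, if_false] <;> positivity
  -- Sampling from `x` amounts to sampling from `y`, where `u` holds the joint weight, and then
  -- recolouring each hit of `u` as `u` or `v` by an independent coin. By `key`, one coin for all
  -- hits does at least as well, and that gives the mixture of `y` and `z`.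
  let sub : Bool → V → V := fun c w => if w = u then (if c then u else v) else w
  let G : (ι → V) → ℝ := fun h => if InducesMultipartite side Adj h then 1 else 0
  -- In a valid assignment the vertices sent to `u` or `v` all lie in one part.
  have key : ∀ (h : ι → V), ∃ i₀ : ι, ∀ β : ι → Bool,
      G (fun i => sub (β i) (h i)) ≤ G (fun i => sub (β i₀) (h i)) := by
    intro h
    by_cases hU : ∃ i₀, h i₀ = u
    · obtain ⟨i₀, hi₀⟩ := hU
      refine ⟨i₀, fun β => ?_⟩
      by_cases hval : InducesMultipartite side Adj (fun i => sub (β i) (h i))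
      · suffices hval' : InducesMultipartite side Adj (fun i => sub (β i₀) (h i)) by
          simp only [G, hval, hval', if_true, le_refl]
        have hvu : ¬ Adj v u := fun hh => hadj (hsymm _ _ hh)
        have hside : ∀ j, h j = u → side j = side i₀ := by
          intro j hj
          by_contra hne
          have := (hval j i₀).2 hne
          simp only [sub, hj, hi₀, if_true] at this
          revert this
          cases β j <;> cases β i₀ <;> simp [hadj, hvu, hirr]
        intro i j
        by_cases hi : h i = u
        · by_cases hj : h j = u
          · simp [hi, hj, sub, hirr, hside i hi, hside j hj]
          · have := hval i₀ j
            simp only [sub, hi₀, hj, if_true, if_false] at this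
            simp only [sub, hi, hj, if_true, if_false, this, hside i hi]
        · by_cases hj : h j = u
          · have := hval i i₀
            simp only [sub, hi₀, hi, if_true, if_false] at this
            simp only [sub, hi, hj, if_true, if_false, this, hside j hj]
          · have := hval i j
            simp only [sub, hi, hj, if_false] at this
            simp only [sub, hi, hj, if_false, this]
      · simp only [G, hval, if_false]
        split_ifs <;> norm_num
    · push Not at hU
      refine ⟨Classical.arbitrary ι, fun β => le_of_eq ?_⟩
      congr 1
      funext i
      simp [sub, hU i]
  have hpush : multipartiteDensity side Adj x =
      ∑ h : ι → V, (∏ i, y (h i)) *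
        ∑ β : ι → Bool, (∏ i, θ (β i)) * G (fun i => sub (β i) (h i)) := by
    have h1 := sum_prod_comp (ι := ι) (fun w : V × Bool => sub w.2 w.1)
      (fun w => y w.1 * θ w.2) G
    have h2 : ∀ a, ∑ w : V × Bool with sub w.2 w.1 = a, y w.1 * θ w.2 = x a := by
      intro a
      rw [Finset.sum_filter, Fintype.sum_prod_type]
      simp only [Fintype.sum_bool, sub, θ, if_true, Bool.false_eq_true, if_false]
      have h3 : ∀ w, ((if (if w = u then u else w) = a then y w * (x u / s) else 0) +
          if (if w = u then v else w) = a then y w * (x v / s) else 0) =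
          (if w = u then (if a = u then x u else 0) + (if a = v then x v else 0) else 0) +
          if w = a then (if w = u then 0 else y w) else 0 := by
        intro w
        by_cases hw : w = u
        · subst hw
          simp only [hy, if_true, eq_comm (a := a)]
          have e1 : s * (x w / s) = x w := by field_simp
          have e2 : s * (x v / s) = x v := by field_simp
          rw [e1, e2]
          simp
        · simp only [hw, if_false, zero_add]
          split_ifs
          · rw [← mul_add, ← add_div, ← hs, div_self hs0.ne', mul_one]
          · simp
      simp_rw [h3]
      rw [Finset.sum_add_distrib, Finset.sum_ite_eq' , Finset.sum_ite_eq']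
      simp only [Finset.mem_univ, if_true, hy]
      by_cases hau : a = u
      · subst hau
        simp [huv]
      · by_cases hav : a = v
        · subst hav
          simp [hau]
        · simp [hau, hav]
    simp_rw [h2] at h1
    unfold multipartiteDensity
    rw [show (∑ h : ι → V, (∏ i, x (h i)) *
        if InducesMultipartite side Adj h then (1 : ℝ) else 0) =
        ∑ h : ι → V, (∏ i, x (h i)) * G h from rfl, ← h1,
      ← (Equiv.arrowProdEquivProdArrow ι (fun _ => V) (fun _ => Bool)).symm.sum_comp,
      Fintype.sum_prod_type]
    refine Finset.sum_congr rfl fun h _ => ?_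
    rw [Finset.mul_sum]
    refine Finset.sum_congr rfl fun β _ => ?_
    rw [← mul_assoc, ← Finset.prod_mul_distrib]
    rfl
  have hfin : ∀ c, ∑ h : ι → V, (∏ i, y (h i)) * G (fun i => sub c (h i)) =
      multipartiteDensity side Adj (if c then y else z) := by
    intro c
    have h1 := sum_prod_comp (ι := ι) (sub c) y G
    rw [show (∑ h : ι → V, (∏ i, y (h i)) * G (fun i => sub c (h i))) =
      ∑ h : ι → V, (∏ i, y (h i)) * G (sub c ∘ h) from rfl, h1]
    unfold multipartiteDensity
    refine Finset.sum_congr rfl fun h _ => ?_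
    congr 1
    refine Finset.prod_congr rfl fun i _ => ?_
    rw [Finset.sum_filter]
    cases c
    · simp only [sub, Bool.false_eq_true, if_false]
      have h3 : ∀ w, (if (if w = u then v else w) = h i then y w else 0) =
          (if w = u then (if v = h i then s else 0) else 0) +
          if w = h i then (if w = u then 0 else y w) else 0 := by
        intro w
        by_cases hw : w = u
        · subst hw; simp [hy]
        · simp [hw]
      simp_rw [h3]
      rw [Finset.sum_add_distrib, Finset.sum_ite_eq' , Finset.sum_ite_eq']
      simp only [Finset.mem_univ, if_true, hy, hz]
      by_cases hau : h i = u
      · simp [hau, huv, huv.symm]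
      · by_cases hav : h i = v
        · simp [hav, huv.symm]
        · simp [hau, hav, Ne.symm hav]
    · have h3 : ∀ w, (if w = u then u else w) = w := fun w => by split_ifs with h <;> simp [h]
      simp [sub, h3]
  rw [hpush]
  calc _ ≤ ∑ h : ι → V, (∏ i, y (h i)) * ∑ c, θ c * G (fun i => sub c (h i)) := by
        refine Finset.sum_le_sum fun h _ => ?_
        refine mul_le_mul_of_nonneg_left ?_ (Finset.prod_nonneg fun i _ => hy0 _)
        obtain ⟨i₀, hi₀⟩ := key h
        rw [← sum_prod_marginal θ hθ i₀ (fun c => G (fun i => sub c (h i)))]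
        exact Finset.sum_le_sum fun β _ =>
          mul_le_mul_of_nonneg_left (hi₀ β) (Finset.prod_nonneg fun i _ => hθ0 _)
    _ = ∑ c, θ c * multipartiteDensity side Adj (if c then y else z) := by
        simp_rw [← hfin, Finset.mul_sum]
        rw [Finset.sum_comm]
        refine Finset.sum_congr rfl fun c _ => Finset.sum_congr rfl fun h _ => by ring
    _ = _ := by simp [θ]

open Classical in
/-- A bound for the density in complete graphs is a bound for the density in every graph. -/
theorem multipartiteDensity_le_of_ne [Nonempty ι] [Fintype V] (side : ι → κ)
    {Adj : V → V → Prop} (hsymm : ∀ i j, Adj i j → Adj j i) (hirr : ∀ i, ¬ Adj i i) {M : ℝ}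
    (hM : ∀ x : V → ℝ, (∀ i, 0 ≤ x i) → ∑ i, x i = 1 →
      multipartiteDensity side (fun i j : V => i ≠ j) x ≤ M)
    {x : V → ℝ} (hx : ∀ i, 0 ≤ x i) (hx1 : ∑ i, x i = 1) :
    multipartiteDensity side Adj x ≤ M := by
  induction hN : (Finset.univ.filter fun i => 0 < x i).card using Nat.strong_induction_on
    generalizing x with
  | _ N ih =>
  subst hN
  -- Merging a nonadjacent pair shrinks the support, so induction applies. Without such a pair the
  -- support is a clique, where `Adj` agrees with `≠`.
  by_cases hcl : ∃ u v, u ≠ v ∧ ¬ Adj u v ∧ 0 < x u ∧ 0 < x v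
  · obtain ⟨u, v, huv, hadj, hu, hv⟩ := hcl
    have hs0 : 0 < x u + x v := by positivity
    have main : ∀ u v, u ≠ v → 0 < x u → 0 < x v → multipartiteDensity side Adj
        (fun i => if i = u then x u + x v else if i = v then 0 else x i) ≤ M := by
      intro u v huv hu hv
      refine ih _ ?_ ?_ ?_ rfl
      · refine Finset.card_lt_card ((Finset.ssubset_iff_of_subset ?_).2 ⟨v, ?_, ?_⟩)
        · intro i
          simp only [Finset.mem_filter, Finset.mem_univ, true_and]
          split_ifs with h1 h2
          · exact fun _ => h1 ▸ hu
          · simp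
          · exact id
        · simpa using hv
        · simp [huv.symm]
      · intro i
        split_ifs
        · positivity
        · exact le_rfl
        · exact hx i
      · rw [← hx1]
        have : ∀ i, (if i = u then x u + x v else if i = v then 0 else x i) =
            x i + ((if i = u then x v else 0) - if i = v then x v else 0) := by
          intro i
          by_cases h1 : i = u
          · simp [h1, huv]
          · by_cases h2 : i = v
            · simp [h2, huv.symm]
            · simp [h1, h2]
        simp_rw [this, Finset.sum_add_distrib, Finset.sum_sub_distrib]
        simp
    have h1 := multipartiteDensity_le_symmetrized side hsymm hirr huv hadj hx hu hv
    have h2 := main u v huv hu hv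
    have h3 := main v u huv.symm hv hu
    rw [add_comm (x v) (x u)] at h3
    calc _ ≤ _ := h1
      _ ≤ x u / (x u + x v) * M + x v / (x u + x v) * M := by gcongr
      _ = M := by rw [← add_mul, ← add_div, div_self hs0.ne', one_mul]
  · push Not at hcl
    refine le_trans (le_of_eq ?_) (hM x hx hx1)
    refine Finset.sum_congr rfl fun h _ => ?_
    by_cases h0 : ∃ i, x (h i) = 0
    · obtain ⟨i, hi⟩ := h0
      rw [Finset.prod_eq_zero (Finset.mem_univ i) hi, zero_mul, zero_mul]
    · push Not at h0
      have hpos : ∀ i, 0 < x (h i) := fun i => lt_of_le_of_ne (hx _) (h0 i).symm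
      have : ∀ i j, Adj (h i) (h j) ↔ h i ≠ h j := by
        refine fun i j => ⟨fun hij heq => hirr _ (heq ▸ hij), fun hne => ?_⟩
        by_contra hna
        exact absurd (hpos j) (not_lt.2 (hcl _ _ hne hna (hpos i)))
      simp only [InducesMultipartite, this]
      congr

end Induced

/-! ### Maximizing over the simplex -/

/-- A local maximum is a critical point, and a positive second derivative makes it a local minimum
too. The function would be locally constant, forcing `f'' = 0`. -/
theorem not_isLocalMax_of_hasDerivAt {f f' : ℝ → ℝ} {f'' : ℝ} (h1 : ∀ t, HasDerivAt f (f' t) t)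
    (h2 : HasDerivAt f' f'' 0) (hpos : 0 < f'') : ¬ IsLocalMax f 0 := by
  intro hmax
  have hd : deriv f = f' := funext fun t => (h1 t).deriv
  have hdd : deriv (deriv f) 0 = f'' := by rw [hd]; exact h2.deriv
  have hmin : IsLocalMin f 0 := isLocalMin_of_deriv_deriv_pos (by rwa [hdd]) hmax.deriv_eq_zero
    (h1 0).continuousAt
  have hc : f =ᶠ[𝓝 0] fun _ => f 0 := by
    filter_upwards [hmax, hmin] with t ht1 ht2 using le_antisymm ht1 ht2
  have := hc.deriv.deriv_eq
  simp only [deriv_const', deriv_const] at this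
  rw [hdd] at this
  exact hpos.ne' this

/-- The second derivative of the density of a complete bipartite graph in a complete multipartite
one, as weight is moved between two parts that are smaller than a third one, is positive. -/
theorem second_derivative_pos {a b : ℕ} (hb : 1 ≤ b) {α β C D : ℝ} (hα : 0 < α) (hβ : 0 < β)
    (hCα : α ^ (a + 2) ≤ C) (hDα : α ^ (b + 2) ≤ D) (hCβ : β ^ (a + 2) ≤ C)
    (hDβ : β ^ (b + 2) ≤ D) :
    0 < D * ((a + 2) * (a + 1)) * (α ^ a + β ^ a) + C * ((b + 2) * (b + 1)) * (α ^ b + β ^ b) +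
      (a + 2) * (a + 1) * (α ^ a * β ^ (b + 2) + β ^ a * α ^ (b + 2)) +
      (b + 2) * (b + 1) * (α ^ b * β ^ (a + 2) + β ^ b * α ^ (a + 2)) -
      2 * ((a + 2) * (b + 2)) * (α ^ (a + 1) * β ^ (b + 1) + α ^ (b + 1) * β ^ (a + 1)) := by
  wlog hle : β ≤ α generalizing α β
  · have := this hβ hα hCβ hDβ hCα hDα (le_of_not_ge hle)
    linarith
  have hb' : (1 : ℝ) ≤ b := by exact_mod_cast hb
  have ha' : (0 : ℝ) ≤ a := by positivity
  set T := α ^ (a + 1) * β ^ (b + 1) + α ^ (b + 1) * β ^ (a + 1) with hT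
  have hT0 : 0 < T := by positivity
  have pw : ∀ n : ℕ, β ^ n ≤ α ^ n := fun n => pow_le_pow_left₀ hβ.le hle n
  have e1 : T ≤ D * (α ^ a + β ^ a) := by
    calc T ≤ α ^ (a + 1) * α ^ (b + 1) + α ^ (b + 1) * (α * β ^ a) := by
          rw [hT, pow_succ β a, mul_comm (β ^ a) β]
          gcongr
      _ = α ^ (b + 2) * (α ^ a + β ^ a) := by ring
      _ ≤ _ := by gcongr
  have e2 : T ≤ C * (α ^ b + β ^ b) := by
    calc T ≤ α ^ (a + 1) * (α * β ^ b) + α ^ (b + 1) * α ^ (a + 1) := by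
          rw [hT, pow_succ β b, mul_comm (β ^ b) β]
          gcongr
      _ = α ^ (a + 2) * (α ^ b + β ^ b) := by ring
      _ ≤ _ := by gcongr
  -- The negative term has coefficient `2 = 11/10 + 9/10`: the mixed terms absorb `11/10`, the terms
  -- in `C` and `D` the rest. As `(a+1)/(a+2) ≥ 1/2` and `(b+1)/(b+2) ≥ 2/3`, AM-GM allows any
  -- constant up to `2/√3 > 11/10`. Here `b ≥ 1` lifts the constant above `1`.
  have am : ∀ s t : ℝ, 0 < s → 0 < t → 11 / 10 * ((a + 2) * (b + 2)) * (s * t) ≤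
      ((a + 2) * (a + 1)) * s ^ 2 + ((b + 2) * (b + 1)) * t ^ 2 := by
    intro s t hs ht
    have h1 : (1 / 2) * ((a + 2) * s) ^ 2 ≤ ((a + 2) * (a + 1)) * s ^ 2 := by
      have : 0 ≤ (a + 2) * a * s ^ 2 := by positivity
      nlinarith
    have h2 : (2 / 3) * ((b + 2) * t) ^ 2 ≤ ((b + 2) * (b + 1)) * t ^ 2 := by
      have : 0 ≤ (b + 2) * (b - 1) * t ^ 2 := by
        have : (0 : ℝ) ≤ b - 1 := by linarith
        positivity
      nlinarith
    nlinarith [sq_nonneg ((a + 2) * s - 11 / 10 * ((b + 2) * t)), sq_nonneg ((b + 2) * t)]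
  have e3 : 11 / 10 * ((a + 2) * (b + 2)) * T ≤
      (a + 2) * (a + 1) * (α ^ a * β ^ (b + 2) + β ^ a * α ^ (b + 2)) +
      (b + 2) * (b + 1) * (α ^ b * β ^ (a + 2) + β ^ b * α ^ (a + 2)) := by
    have h1 := mul_le_mul_of_nonneg_left (am β α hβ hα) (by positivity : 0 ≤ α ^ a * β ^ b)
    have h2 := mul_le_mul_of_nonneg_left (am α β hα hβ) (by positivity : 0 ≤ β ^ a * α ^ b)
    calc _ = α ^ a * β ^ b * (11 / 10 * ((a + 2) * (b + 2)) * (β * α)) +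
          β ^ a * α ^ b * (11 / 10 * ((a + 2) * (b + 2)) * (α * β)) := by rw [hT]; ring
      _ ≤ _ := add_le_add h1 h2
      _ = _ := by ring
  have e4 : 0 < (((a : ℝ) + 2) * (a + 1) + (b + 2) * (b + 1) - 9 / 10 * ((a + 2) * (b + 2))) * T := by
    refine mul_pos ?_ hT0
    nlinarith [sq_nonneg ((a : ℝ) + 2 - 9 / 10 * (b + 2)), mul_nonneg ha' ha']
  have e5 := mul_le_mul_of_nonneg_left e1 (by positivity : (0 : ℝ) ≤ (a + 2) * (a + 1))
  have e6 := mul_le_mul_of_nonneg_left e2 (by positivity : (0 : ℝ) ≤ (b + 2) * (b + 1))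
  linarith

/-- Moving weight between two parts that are smaller than a third one is never locally optimal. -/
theorem not_isLocalMax_transfer {a b : ℕ} (hb : 1 ≤ b) {α β C D E : ℝ} (hα : 0 < α) (hβ : 0 < β)
    (hCα : α ^ (a + 2) ≤ C) (hDα : α ^ (b + 2) ≤ D) (hCβ : β ^ (a + 2) ≤ C)
    (hDβ : β ^ (b + 2) ≤ D) :
    ¬ IsLocalMax (fun t : ℝ => (C + ((α + t) ^ (a + 2) + (β - t) ^ (a + 2))) *
      (D + ((α + t) ^ (b + 2) + (β - t) ^ (b + 2))) -
      (E + ((α + t) ^ (a + b + 4) + (β - t) ^ (a + b + 4)))) 0 := by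
  have hp : ∀ (n : ℕ) (t : ℝ), HasDerivAt (fun t => (α + t) ^ (n + 1)) ((n + 1) * (α + t) ^ n) t := by
    intro n t
    simpa using ((hasDerivAt_id t).const_add α).fun_pow (n + 1)
  have hm : ∀ (n : ℕ) (t : ℝ),
      HasDerivAt (fun t => (β - t) ^ (n + 1)) (-((n + 1) * (β - t) ^ n)) t := by
    intro n t
    simpa using ((hasDerivAt_id t).const_sub β).fun_pow (n + 1)
  -- The pure powers of exponent `a + b + 4` cancel; `E` survives only in the constant.
  have hfun : (fun t : ℝ => (C + ((α + t) ^ (a + 2) + (β - t) ^ (a + 2))) *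
      (D + ((α + t) ^ (b + 2) + (β - t) ^ (b + 2))) -
      (E + ((α + t) ^ (a + b + 4) + (β - t) ^ (a + b + 4)))) = fun t =>
      C * ((α + t) ^ (b + 1 + 1) + (β - t) ^ (b + 1 + 1)) +
      D * ((α + t) ^ (a + 1 + 1) + (β - t) ^ (a + 1 + 1)) +
      ((α + t) ^ (a + 1 + 1) * (β - t) ^ (b + 1 + 1) +
        (α + t) ^ (b + 1 + 1) * (β - t) ^ (a + 1 + 1)) + (C * D - E) := by
    funext t
    ring
  rw [hfun]
  have d1 := fun t => (((((hp (b + 1) t).add (hm (b + 1) t)).const_mul C).add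
    (((hp (a + 1) t).add (hm (a + 1) t)).const_mul D)).add
    (((hp (a + 1) t).mul (hm (b + 1) t)).add ((hp (b + 1) t).mul (hm (a + 1) t)))).add_const
    (C * D - E)
  have q : ∀ n : ℕ, HasDerivAt (fun t => ((n + 1 : ℕ) + 1 : ℝ) * (α + t) ^ (n + 1))
      (((n + 1 : ℕ) + 1) * ((n + 1) * (α + 0) ^ n)) 0 := fun n => (hp n 0).const_mul _
  have r : ∀ n : ℕ, HasDerivAt (fun t => -(((n + 1 : ℕ) + 1 : ℝ) * (β - t) ^ (n + 1)))
      (-(((n + 1 : ℕ) + 1) * -((n + 1) * (β - 0) ^ n))) 0 := fun n => ((hm n 0).const_mul _).neg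
  have d2 := ((((q b).add (r b)).const_mul C).add (((q a).add (r a)).const_mul D)).add
    ((((q a).mul (hm (b + 1) 0)).add ((hp (a + 1) 0).mul (r b))).add
      (((q b).mul (hm (a + 1) 0)).add ((hp (b + 1) 0).mul (r a))))
  refine not_isLocalMax_of_hasDerivAt d1 d2 ?_
  refine lt_of_lt_of_eq (second_derivative_pos hb hα hβ hCα hDα hCβ hDβ) ?_
  push_cast
  ring

-- In a complete graph a valid assignment is constant on each side, with two different values. The
-- sum thus runs over ordered pairs of distinct vertices: the full product minus its diagonal.
open Classical in
theorem multipartiteDensity_ne_eq {V : Type*} [Fintype V] {a b : ℕ} (ha : 0 < a) (hb : 0 < b)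
    (x : V → ℝ) :
    multipartiteDensity (Sum.isLeft : Fin a ⊕ Fin b → Bool) (fun i j : V => i ≠ j) x =
      (∑ i, x i ^ a) * (∑ i, x i ^ b) - ∑ i, x i ^ (a + b) := by
  have h1 : (∑ i, x i ^ a) * (∑ i, x i ^ b) - ∑ i, x i ^ (a + b) =
      ∑ q : V × V with q.1 ≠ q.2, x q.1 ^ a * x q.2 ^ b := by
    rw [Finset.sum_mul_sum, Finset.sum_filter, Fintype.sum_prod_type, ← Finset.sum_sub_distrib]
    refine Finset.sum_congr rfl fun i _ => ?_
    have : ∀ j, (if i ≠ j then x i ^ a * x j ^ b else 0) =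
        x i ^ a * x j ^ b - if i = j then x i ^ (a + b) else 0 := by
      intro j
      by_cases h : i = j
      · subst h; simp [pow_add]
      · simp [h]
    simp_rw [this]
    simp
  rw [h1]
  unfold multipartiteDensity
  simp_rw [mul_ite, mul_one, mul_zero]
  rw [← Finset.sum_filter]
  symm
  refine Finset.sum_bij' (fun q _ => Sum.elim (fun _ => q.1) (fun _ => q.2))
    (fun h _ => (h (Sum.inl ⟨0, ha⟩), h (Sum.inr ⟨0, hb⟩))) ?_ ?_ ?_ ?_ ?_
  · rintro ⟨i, j⟩ hij
    simp only [Finset.mem_filter, Finset.mem_univ, true_and] at hij ⊢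
    rintro (_ | _) (_ | _) <;> simp [hij, Ne.symm hij]
  · intro h hh
    simp only [Finset.mem_filter, Finset.mem_univ, true_and] at hh ⊢
    exact (hh _ _).2 (by simp)
  · rintro ⟨i, j⟩ _
    rfl
  · intro h hh
    simp only [Finset.mem_filter, Finset.mem_univ, true_and] at hh
    funext z
    rcases z with i | j
    · have := hh (Sum.inl ⟨0, ha⟩) (Sum.inl i)
      simpa using this
    · have := hh (Sum.inr ⟨0, hb⟩) (Sum.inr j)
      simpa using this
  · rintro ⟨i, j⟩ _
    simp [Fintype.prod_sum_type]

open Classical in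
theorem multipartiteDensity_ne_le {V : Type*} [Fintype V] {a b : ℕ} (ha : 2 ≤ a) (hab : a < b)
    {M : ℝ} (hM : ∀ t ∈ Set.Icc (0 : ℝ) 1, t ^ a * (1 - t) ^ b + t ^ b * (1 - t) ^ a ≤ M)
    {x : V → ℝ} (hx : ∀ i, 0 ≤ x i) (hx1 : ∑ i, x i = 1) :
    multipartiteDensity (Sum.isLeft : Fin a ⊕ Fin b → Bool) (fun i j : V => i ≠ j) x ≤ M := by
  rw [multipartiteDensity_ne_eq (by omega) (by omega)]
  obtain ⟨y, ⟨hy0, hy1⟩, hymax⟩ := (isCompact_stdSimplex ℝ V).exists_isMaxOn ⟨x, hx, hx1⟩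
    (f := fun x : V → ℝ => (∑ i, x i ^ a) * (∑ i, x i ^ b) - ∑ i, x i ^ (a + b))
    (by fun_prop)
  refine le_trans (hymax ⟨hx, hx1⟩) ?_
  have hV : Nonempty V := by
    by_contra hne
    rw [not_nonempty_iff] at hne
    simp at hx1
  obtain ⟨w, hw⟩ := Finite.exists_max y
  by_cases hsupp : ∃ u v, u ≠ v ∧ u ≠ w ∧ v ≠ w ∧ 0 < y u ∧ 0 < y v
  · exfalso
    obtain ⟨u, v, huv, huw, hvw, hu, hv⟩ := hsupp
    obtain ⟨a, rfl⟩ := Nat.exists_eq_add_of_le' ha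
    obtain ⟨b, rfl⟩ := Nat.exists_eq_add_of_le' (by omega : 2 ≤ b)
    let c : ℕ → ℝ := fun k => ∑ i ∈ (Finset.univ.erase u).erase v, y i ^ k
    -- The heaviest vertex `w` stays in the remainder, so the remaining power sums dominate the
    -- powers of `y u` and `y v`, as the transfer lemma requires.
    have hc : ∀ k, y w ^ k ≤ c k := fun k =>
      Finset.single_le_sum (f := fun i => y i ^ k) (fun i _ => pow_nonneg (hy0 i) k)
        (by simp [huw.symm, hvw.symm])
    let z : ℝ → V → ℝ := fun t i => if i = u then y u + t else if i = v then y v - t else y i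
    have hsum : ∀ (f : ℝ → ℝ) (t : ℝ), ∑ i, f (z t i) =
        ∑ i ∈ (Finset.univ.erase u).erase v, f (y i) + (f (y u + t) + f (y v - t)) := by
      intro f t
      rw [← Finset.add_sum_erase _ _ (Finset.mem_univ u),
        ← Finset.add_sum_erase (Finset.univ.erase u) _ (by simp [huv.symm] : v ∈ _)]
      have : ∑ i ∈ (Finset.univ.erase u).erase v, f (z t i) =
          ∑ i ∈ (Finset.univ.erase u).erase v, f (y i) := by
        refine Finset.sum_congr rfl fun i hi => ?_
        simp only [Finset.mem_erase] at hi
        simp [z, hi.1, hi.2.1]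
      rw [this]
      simp only [z, if_true, huv.symm, if_false]
      ring
    have hz0 : z 0 = y := by
      funext i
      simp only [z, add_zero, sub_zero]
      split_ifs with h1 h2
      · rw [h1]
      · rw [h2]
      · rfl
    have hz1 : ∀ t, ∑ i, z t i = 1 := by
      intro t
      have h1 := hsum id t
      have h2 := hsum id 0
      simp only [id, hz0, hy1] at h1 h2
      linarith
    have hup : ∀ k, y u ^ k ≤ c k := fun k => (pow_le_pow_left₀ hu.le (hw u) k).trans (hc k)
    have hvp : ∀ k, y v ^ k ≤ c k := fun k => (pow_le_pow_left₀ hv.le (hw v) k).trans (hc k)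
    refine not_isLocalMax_transfer (a := a) (b := b) (by omega) hu hv (hup _) (hup _) (hvp _)
      (hvp _) (E := c (a + b + 4)) ?_
    have hval : ∀ t, (∑ i, z t i ^ (a + 2)) * (∑ i, z t i ^ (b + 2)) -
        ∑ i, z t i ^ (a + 2 + (b + 2)) =
        (c (a + 2) + ((y u + t) ^ (a + 2) + (y v - t) ^ (a + 2))) *
        (c (b + 2) + ((y u + t) ^ (b + 2) + (y v - t) ^ (b + 2))) -
        (c (a + b + 4) + ((y u + t) ^ (a + b + 4) + (y v - t) ^ (a + b + 4))) := by
      intro t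
      rw [hsum (fun r => r ^ (a + 2)), hsum (fun r => r ^ (b + 2)),
        hsum (fun r => r ^ (a + 2 + (b + 2))), show a + 2 + (b + 2) = a + b + 4 by ring]
    filter_upwards [Ioo_mem_nhds (neg_lt_zero.2 hu) hv] with t ht
    rw [← hval, ← hval, hz0]
    refine hymax ⟨fun i => ?_, hz1 t⟩
    simp only [z]
    split_ifs
    · linarith [ht.1]
    · linarith [ht.2]
    · exact hy0 i
  · push Not at hsupp
    have hpair : ∃ v, ∀ i, i ≠ w → i ≠ v → y i = 0 := by
      by_cases h : ∃ v, v ≠ w ∧ 0 < y v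
      · obtain ⟨v, hvw, hv⟩ := h
        exact ⟨v, fun i hiw hiv => le_antisymm (hsupp v i hiv.symm hvw hiw hv) (hy0 i)⟩
      · push Not at h
        exact ⟨w, fun i hiw _ => le_antisymm (h i hiw) (hy0 i)⟩
    obtain ⟨v, hv⟩ := hpair
    by_cases hvw : v = w
    · subst hvw
      have hs : ∀ k, 0 < k → ∑ i, y i ^ k = y v ^ k := fun k hk =>
        Fintype.sum_eq_single v fun i hi => by rw [hv i hi hi, zero_pow hk.ne']
      -- With one vertex left the density is zero; evaluating at `t = 0` gives `0 ≤ M`.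
      have := hM 0 (by simp)
      rw [zero_pow (by omega), zero_pow (by omega)] at this
      dsimp only
      rw [hs a (by omega), hs b (by omega), hs (a + b) (by omega), pow_add]
      linarith
    · have hs : ∀ k, 0 < k → ∑ i, y i ^ k = y w ^ k + y v ^ k := fun k hk =>
        Fintype.sum_eq_add w v (Ne.symm hvw) fun i hi => by
          rw [hv i hi.1 hi.2, zero_pow hk.ne']
      have h1 := hs 1 one_pos
      simp only [pow_one, hy1] at h1
      have hyv : y v = 1 - y w := by linarith
      have := hM (y w) ⟨hy0 w, by linarith [hy0 v]⟩
      dsimp only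
      rw [hs a (by omega), hs b (by omega), hs (a + b) (by omega), hyv, pow_add, pow_add]
      linarith

/-- With `y = x(1-x) ≤ 1/4` the function is `y^a` when `b = a + 1`, and `y^(a-1) * (y(1-2y))` when
`b = a + 2`. Here `1/8 - y(1-2y) = 2(y-1/4)²`, so both factors peak at `y = 1/4`. -/
theorem isMaxOn_half {a b : ℕ} (ha : 2 ≤ a) (hab : a < b) (h : b - a = 1 ∨ b - a = 2) :
    IsMaxOn (fun x : ℝ => x ^ a * (1 - x) ^ b + x ^ b * (1 - x) ^ a) (Set.Icc 0 1) (1 / 2) := by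
  intro x hx
  have hy0 : 0 ≤ x * (1 - x) := mul_nonneg hx.1 (by linarith [hx.2])
  have hy1 : x * (1 - x) ≤ 1 / 4 := by nlinarith [sq_nonneg (x - 1 / 2)]
  have hp : ∀ n : ℕ, (x * (1 - x)) ^ n ≤ (1 / 4) ^ n := fun n => pow_le_pow_left₀ hy0 hy1 n
  have hq : (1 / 4 : ℝ) = 1 / 2 * (1 / 2) := by norm_num
  simp only [Set.mem_ofPred_eq]
  rcases h with h | h
  · obtain rfl : b = a + 1 := by omega
    calc _ = (x * (1 - x)) ^ a := by rw [mul_pow]; ring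
      _ ≤ (1 / 4) ^ a := hp a
      _ = _ := by rw [hq, mul_pow]; ring
  · obtain rfl : b = a + 2 := by omega
    obtain ⟨c, rfl⟩ := Nat.exists_eq_add_of_le' ha
    have h8 : x * (1 - x) * (1 - 2 * (x * (1 - x))) ≤ 1 / 8 := by
      nlinarith [sq_nonneg (x * (1 - x) - 1 / 4)]
    have h9 : 0 ≤ x * (1 - x) * (1 - 2 * (x * (1 - x))) := mul_nonneg hy0 (by linarith)
    calc _ = (x * (1 - x)) ^ (c + 1) * (x * (1 - x) * (1 - 2 * (x * (1 - x)))) := by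
          rw [mul_pow]; ring
      _ ≤ (1 / 4) ^ (c + 1) * (1 / 8) := by gcongr
      _ = _ := by rw [hq, mul_pow]; ring

/-! ### Layered patterns and their occurrences -/

section Layered

/-- The order of the letters at positions `i`, `j` (numbered from `0`) of a layered permutation
with two layers, the first of length `p`. -/
def LayeredLT (p i j : ℕ) : Prop := (i < p ∧ p ≤ j) ∨ (j < i ∧ (i < p ∨ p ≤ j))

theorem layeredPerm_twoParts_val {m p q : ℕ} (hp : 0 < p) (hq : 0 < q) (h : p + q = m)
    (i : Fin m) : (layeredPerm (twoParts m p q hp hq h) i : ℕ) =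
      if (i : ℕ) < p then p - 1 - i else p + (q - 1 - (i - p)) := by
  have hlen : (twoParts m p q hp hq h).length = 2 := rfl
  have key : ∀ (l : Fin (twoParts m p q hp hq h).length)
      (t : Fin ((twoParts m p q hp hq h).blocksFun l)),
      layeredPerm (twoParts m p q hp hq h) ((twoParts m p q hp hq h).embedding l t) =
        (twoParts m p q hp hq h).embedding l (Fin.rev t) := by
    intro l t
    have h1 := (twoParts m p q hp hq h).index_embedding l t
    have h2 := (twoParts m p q hp hq h).invEmbedding_comp l t
    apply Fin.ext
    simp only [layeredPerm, Composition.coe_embedding, Fin.val_rev]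
    rw [h2, h1]
  split_ifs with hi
  · have e : i = (twoParts m p q hp hq h).embedding ⟨0, by rw [hlen]; norm_num⟩ ⟨i, hi⟩ := by
      apply Fin.ext
      rw [Composition.coe_embedding]
      simp
    conv_lhs => rw [e, key, Composition.coe_embedding, Fin.val_rev]
    simp [twoParts, Composition.blocksFun]
    omega
  · have e : i = (twoParts m p q hp hq h).embedding ⟨1, by rw [hlen]; norm_num⟩
        ⟨i - p, by simp only [twoParts, Composition.blocksFun, List.get_eq_getElem,
          List.getElem_cons_succ, List.getElem_cons_zero]; omega⟩ := by
      apply Fin.ext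
      rw [Composition.coe_embedding]
      simp [Composition.sizeUpTo, twoParts]
      omega
    conv_lhs => rw [e, key, Composition.coe_embedding, Fin.val_rev]
    simp [twoParts, Composition.blocksFun, Composition.sizeUpTo]
    omega

theorem layeredPerm_twoParts_lt_iff {m p q : ℕ} (hp : 0 < p) (hq : 0 < q) (h : p + q = m)
    (i j : Fin m) : layeredPerm (twoParts m p q hp hq h) i < layeredPerm (twoParts m p q hp hq h) j ↔
      LayeredLT p i j := by
  rw [Fin.lt_def, layeredPerm_twoParts_val, layeredPerm_twoParts_val, LayeredLT]
  split_ifs <;> omega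

/-- The occurrences in `σ` of the layered permutation with two layers, the first of length `p`. -/
def layeredOccurrences (m p : ℕ) {n : ℕ} {α : Type*} [LT α] (σ : Fin n → α) :
    Set (Fin m ↪o Fin n) :=
  {e | ∀ i j, σ (e i) < σ (e j) ↔ LayeredLT p i j}

theorem occurrences_pair {a b k n : ℕ} (ha : 0 < a) (hb : 0 < b) (h : b + a = a + b)
    (σ : Fin n → Fin k) :
    occurrences ({layeredPerm (twoParts (a + b) a b ha hb rfl),
      layeredPerm (twoParts (a + b) b a hb ha h)} : Set (Fin (a + b) → Fin (a + b))) σ =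
      (layeredOccurrences (a + b) a σ ∪ layeredOccurrences (a + b) b σ).ncard := by
  unfold occurrences
  congr 1
  ext e
  simp [OrderIsomorphicWords, layeredOccurrences, layeredPerm_twoParts_lt_iff]

theorem disjoint_layeredOccurrences {m a b n : ℕ} {α : Type*} [LT α] (ha : 0 < a) (hab : a < b)
    (hb : b < m) (σ : Fin n → α) :
    Disjoint (layeredOccurrences m a σ) (layeredOccurrences m b σ) := by
  rw [Set.disjoint_left]
  intro e h1 h2
  -- Positions `0` and `a` form an ascent in `[a,b]` but share the first layer of `[b,a]`.
  have h3 := (h1 ⟨0, by omega⟩ ⟨a, by omega⟩).symm.trans (h2 ⟨0, by omega⟩ ⟨a, by omega⟩)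
  simp only [LayeredLT] at h3
  omega

/-- Two positions of a word carry distinct letters in increasing order. -/
def IncreasingPair {n k : ℕ} (σ : Fin n → Fin k) (i j : Fin n) : Prop :=
  (i < j ∧ σ i < σ j) ∨ (j < i ∧ σ j < σ i)

theorem increasingPair_iff {m p n k : ℕ} {σ : Fin n → Fin k} {e : Fin m ↪o Fin n}
    (he : e ∈ layeredOccurrences m p σ) (i j : Fin m) :
    IncreasingPair σ (e i) (e j) ↔ ¬ ((i : ℕ) < p ↔ (j : ℕ) < p) := by
  rw [IncreasingPair, he i j, he j i, e.lt_iff_lt, e.lt_iff_lt, Fin.lt_def, Fin.lt_def, LayeredLT,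
    LayeredLT]
  omega

-- Permuting the labels within each side of an occurrence gives `a! b!` labelled copies of
-- `K_{a,b}`. The range of a copy recovers the occurrence, so none is counted twice.
open Classical in
theorem ncard_mul_factorial_le {a b k n : ℕ} (σ : Fin n → Fin k) :
    (layeredOccurrences (a + b) a σ ∪ layeredOccurrences (a + b) b σ).ncard *
      (a.factorial * b.factorial) ≤
    (Finset.univ.filter fun h : Fin a ⊕ Fin b → Fin n =>
      InducesMultipartite Sum.isLeft (IncreasingPair σ) h).card := by
  set S := layeredOccurrences (a + b) a σ ∪ layeredOccurrences (a + b) b σ with hS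
  let ρ₁ : Fin a ⊕ Fin b ≃ Fin (a + b) := finSumFinEquiv
  -- For `[b,a]` the side of size `b` must label the first layer, hence the swap.
  let ρ₂ : Fin a ⊕ Fin b ≃ Fin (a + b) :=
    (Equiv.sumComm _ _).trans (finSumFinEquiv.trans (finCongr (Nat.add_comm b a)))
  let ρ : (Fin (a + b) ↪o Fin n) → (Fin a ⊕ Fin b ≃ Fin (a + b)) := fun e =>
    if e ∈ layeredOccurrences (a + b) a σ then ρ₁ else ρ₂
  let F : S × (Equiv.Perm (Fin a) × Equiv.Perm (Fin b)) → (Fin a ⊕ Fin b → Fin n) :=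
    fun w => fun z => w.1.1 (ρ w.1.1 (Sum.map w.2.1 w.2.2 z))
  have hF : Function.Injective F := by
    rintro ⟨⟨e, he⟩, s, t⟩ ⟨⟨e', he'⟩, s', t'⟩ heq
    have hr : ∀ (e : Fin (a + b) ↪o Fin n) (he : e ∈ S) (s : Equiv.Perm (Fin a))
        (t : Equiv.Perm (Fin b)), Set.range (F (⟨e, he⟩, s, t)) = Set.range e := by
      intro e he s t
      have : F (⟨e, he⟩, s, t) = e ∘ ((Equiv.sumCongr s t).trans (ρ e)) := rfl
      rw [this, Set.range_comp, Equiv.range_eq_univ, Set.image_univ]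
    have hee : e = e' := by
      rw [← OrderEmbedding.range_inj, ← hr e he s t, ← hr e' he' s' t', heq]
    subst hee
    have h1 : ∀ z, Sum.map s t z = Sum.map s' t' z := fun z =>
      (ρ e).injective (e.injective (congrFun heq z))
    have h2 : s = s' := Equiv.ext fun i => by simpa using h1 (Sum.inl i)
    have h3 : t = t' := Equiv.ext fun i => by simpa using h1 (Sum.inr i)
    rw [h2, h3]
  have hmem : ∀ w, InducesMultipartite Sum.isLeft (IncreasingPair σ) (F w) := by
    rintro ⟨⟨e, he⟩, s, t⟩ z z'
    by_cases hea : e ∈ layeredOccurrences (a + b) a σ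
    · simp only [F, ρ, hea, if_true]
      rw [increasingPair_iff hea]
      rcases z with z | z <;> rcases z' with z' | z' <;> simp [ρ₁]
    · have heb : e ∈ layeredOccurrences (a + b) b σ := he.resolve_left hea
      simp only [F, ρ, hea, if_false]
      rw [increasingPair_iff heb]
      rcases z with z | z <;> rcases z' with z' | z' <;> simp [ρ₂]
  have hcard := Finset.card_le_card_of_injOn (s := Finset.univ) F
    (t := Finset.univ.filter fun h : Fin a ⊕ Fin b → Fin n =>
      InducesMultipartite Sum.isLeft (IncreasingPair σ) h)
    (fun w _ => by simpa using hmem w) hF.injOn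
  refine le_trans (le_of_eq ?_) hcard
  rw [Finset.card_univ, Fintype.card_prod, Fintype.card_prod, Fintype.card_perm,
    Fintype.card_perm, Fintype.card_fin, Fintype.card_fin, ← Nat.card_eq_fintype_card,
    Nat.card_coe_set_eq]

theorem ncard_layeredOccurrences_le {a b k n : ℕ} (ha : 2 ≤ a) (hab : a < b) (hn : 0 < n) {M : ℝ}
    (hM : ∀ t ∈ Set.Icc (0 : ℝ) 1, t ^ a * (1 - t) ^ b + t ^ b * (1 - t) ^ a ≤ M)
    (σ : Fin n → Fin k) :
    ((layeredOccurrences (a + b) a σ ∪ layeredOccurrences (a + b) b σ).ncard : ℝ) *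
      (a.factorial * b.factorial) ≤ M * n ^ (a + b) := by
  classical
  have : Nonempty (Fin a ⊕ Fin b) := ⟨Sum.inl ⟨0, by omega⟩⟩
  have hn' : (0 : ℝ) < n := by exact_mod_cast hn
  -- Uniform weights `1/n` turn the density into the number of copies divided by `n^(a+b)`.
  have h1 := multipartiteDensity_le_of_ne (ι := Fin a ⊕ Fin b) (V := Fin n) Sum.isLeft
    (Adj := IncreasingPair σ) (fun i j h => Or.symm h)
    (fun i h => by rcases h with h | h <;> exact lt_irrefl _ h.1)
    (fun x hx hx1 => multipartiteDensity_ne_le ha hab hM hx hx1) (x := fun _ => (n : ℝ)⁻¹)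
    (fun _ => by positivity) (by simp [hn'.ne'])
  unfold multipartiteDensity at h1
  rw [← Finset.mul_sum] at h1
  simp only [Finset.prod_const, Finset.card_univ, Fintype.card_sum, Fintype.card_fin,
    Finset.sum_boole] at h1
  have h2 := ncard_mul_factorial_le (a := a) (b := b) σ
  calc _ ≤ ((Finset.univ.filter fun h : Fin a ⊕ Fin b → Fin n =>
        InducesMultipartite Sum.isLeft (IncreasingPair σ) h).card : ℝ) := by exact_mod_cast h2
    _ = ((n : ℝ)⁻¹ ^ (a + b) * (Finset.univ.filter fun h : Fin a ⊕ Fin b → Fin n =>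
        InducesMultipartite Sum.isLeft (IncreasingPair σ) h).card) * n ^ (a + b) := by
        rw [inv_pow]
        field_simp
    _ ≤ _ := by
        refine mul_le_mul_of_nonneg_right (le_trans (le_of_eq ?_) h1) (by positivity)
        congr!

theorem choose_le_card_orderEmbedding (p r : ℕ) :
    r.choose p ≤ Fintype.card (Fin p ↪o Fin r) := by
  have : r.choose p = Fintype.card {s : Finset (Fin r) // s.card = p} := by
    simp
  rw [this]
  refine Fintype.card_le_of_injective (fun s => s.1.orderEmbOfFin s.2) ?_
  intro s t hst
  apply Subtype.ext
  rw [← Finset.coe_inj, ← Finset.range_orderEmbOfFin s.1 s.2, ← Finset.range_orderEmbOfFin t.1 t.2]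
  exact congrArg (fun e : Fin p ↪o Fin r => Set.range e) hst

/-- The layered permutation with layers of lengths `r` and `s`, numbered from `0`. -/
def twoLayers (r s : ℕ) (i : Fin (r + s)) : Fin (r + s) :=
  if h : (i : ℕ) < r then ⟨r - 1 - i, by omega⟩ else ⟨r + s - 1 - (i - r), by omega⟩

theorem twoLayers_lt_iff {r s : ℕ} (i j : Fin (r + s)) :
    twoLayers r s i < twoLayers r s j ↔ LayeredLT r i j := by
  unfold twoLayers LayeredLT
  split_ifs <;> simp only [Fin.mk_lt_mk] <;> omega

/-- Any `p` positions of the first layer followed by any `q` of the second form an occurrence. -/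
theorem choose_mul_choose_le_ncard {m p q : ℕ} (h : p + q = m) (r s : ℕ) :
    r.choose p * s.choose q ≤ (layeredOccurrences m p (twoLayers r s)).ncard := by
  subst h
  let F : (Fin p ↪o Fin r) × (Fin q ↪o Fin s) → (Fin (p + q) ↪o Fin (r + s)) := fun w =>
    OrderEmbedding.ofStrictMono
      (Fin.append (fun i => Fin.castAdd s (w.1 i)) (fun j => Fin.natAdd r (w.2 j))) (by
        intro i j hij
        induction i using Fin.addCases with
        | left i =>
          induction j using Fin.addCases with
          | left j =>
            simp only [Fin.append_left, Fin.lt_def, Fin.val_castAdd] at hij ⊢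
            exact w.1.strictMono hij
          | right j =>
            simp only [Fin.append_left, Fin.append_right, Fin.lt_def, Fin.val_castAdd,
              Fin.val_natAdd]
            omega
        | right i =>
          induction j using Fin.addCases with
          | left j =>
            simp only [Fin.lt_def, Fin.val_castAdd, Fin.val_natAdd] at hij
            omega
          | right j => simpa using hij)
  have hl : ∀ w i, F w (Fin.castAdd q i) = Fin.castAdd s (w.1 i) := fun w i =>
    Fin.append_left (fun i => Fin.castAdd s (w.1 i)) (fun j => Fin.natAdd r (w.2 j)) i
  have hr : ∀ w j, F w (Fin.natAdd p j) = Fin.natAdd r (w.2 j) := fun w j =>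
    Fin.append_right (fun i => Fin.castAdd s (w.1 i)) (fun j => Fin.natAdd r (w.2 j)) j
  have hF : Function.Injective F := by
    rintro ⟨e, f⟩ ⟨e', f'⟩ heq
    refine Prod.ext (RelEmbedding.ext fun i => ?_) (RelEmbedding.ext fun j => ?_)
    · have h1 := hl (e, f) i
      rw [heq, hl] at h1
      simpa using h1.symm
    · have h1 := hr (e, f) j
      rw [heq, hr] at h1
      simpa using h1.symm
  have hmem : ∀ w, F w ∈ layeredOccurrences (p + q) p (twoLayers r s) := by
    intro w i j
    rw [twoLayers_lt_iff]
    have hlt : (i < j ↔ F w i < F w j) ∧ (j < i ↔ F w j < F w i) :=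
      ⟨(F w).lt_iff_lt.symm, (F w).lt_iff_lt.symm⟩
    have hside : ∀ i, ((F w i : ℕ) < r ↔ (i : ℕ) < p) := by
      intro i
      induction i using Fin.addCases with
      | left i => rw [hl]; simp
      | right i => rw [hr]; simp
    have hi := hside i
    have hj := hside j
    simp only [Fin.lt_def] at hlt
    unfold LayeredLT
    omega
  calc _ ≤ Fintype.card ((Fin p ↪o Fin r) × (Fin q ↪o Fin s)) := by
        rw [Fintype.card_prod]
        exact Nat.mul_le_mul (choose_le_card_orderEmbedding p r) (choose_le_card_orderEmbedding q s)
    _ = (Set.range F).ncard := by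
        rw [← Set.image_univ, Set.ncard_image_of_injective _ hF, Set.ncard_univ,
          Nat.card_eq_fintype_card]
    _ ≤ _ := Set.ncard_le_ncard (Set.range_subset_iff.2 hmem) (Set.toFinite _)

theorem choose_mul_choose_add_le_occurrences {a b : ℕ} (ha : 0 < a) (hab : a < b)
    (h : b + a = a + b) (r s : ℕ) :
    r.choose a * s.choose b + r.choose b * s.choose a ≤
      occurrences ({layeredPerm (twoParts (a + b) a b ha (ha.trans hab) rfl),
        layeredPerm (twoParts (a + b) b a (ha.trans hab) ha h)} :
        Set (Fin (a + b) → Fin (a + b))) (twoLayers r s) := by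
  rw [occurrences_pair, Set.ncard_union_eq
    (disjoint_layeredOccurrences ha hab (by omega) _) (Set.toFinite _) (Set.toFinite _)]
  exact Nat.add_le_add (choose_mul_choose_le_ncard rfl r s) (choose_mul_choose_le_ncard h r s)

end Layered

/-! ### Monotonicity, blow-ups and the iterated limits -/

section Words

variable {l m : ℕ} (P : Set (Fin m → Fin l))

/-- The occurrences in the word `σ` of patterns of `P`. -/
def occurrenceSet {k n : ℕ} (σ : Fin n → Fin k) : Set (Fin m ↪o Fin n) :=
  {e | ∃ π ∈ P, OrderIsomorphicWords (fun i => σ (e i)) π}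

theorem occurrences_le_maxOccurrences {k n : ℕ} (σ : Fin n → Fin k) :
    occurrences P σ ≤ maxOccurrences P k n :=
  Finset.le_sup (f := fun σ : Fin n → Fin k => occurrences P σ) (Finset.mem_univ σ)

theorem maxOccurrences_le_card (k n : ℕ) :
    maxOccurrences P k n ≤ Nat.card (Fin m ↪o Fin n) :=
  Finset.sup_le fun _ _ => Set.ncard_le_card _

theorem maxOccurrences_mono (n : ℕ) : Monotone fun k => maxOccurrences P k n := by
  intro k k' hk
  refine Finset.sup_le fun σ _ => ?_
  exact occurrences_le_maxOccurrences P fun i => Fin.castLE hk (σ i)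

-- Double counting of pairs of an occurrence and a position it avoids: each occurrence avoids `n + 1
-- - m` positions, and one avoiding `i` survives the deletion of letter `i`.
open Classical in
theorem occurrences_mul_le_sum {k n : ℕ} (σ : Fin (n + 1) → Fin k) :
    occurrences P σ * (n + 1 - m) ≤
      ∑ i : Fin (n + 1), occurrences P (fun j => σ (i.succAbove j)) := by
  set O := (occurrenceSet P σ).toFinset with hO
  have h1 : ∀ i : Fin (n + 1), (O.filter fun e : Fin m ↪o Fin (n + 1) => i ∉ Set.range e).card ≤
      occurrences P (fun j => σ (i.succAbove j)) := by
    intro i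
    have hsub : ((O.filter fun e : Fin m ↪o Fin (n + 1) => i ∉ Set.range e : Finset _) :
        Set (Fin m ↪o Fin (n + 1))) ⊆
        (fun e => e.trans i.succAboveOrderEmb) '' occurrenceSet P (fun j => σ (i.succAbove j)) := by
      intro e he
      simp only [hO, Finset.coe_filter, Set.mem_toFinset, Set.mem_ofPred_eq] at he
      have hex : ∀ j, ∃ f, i.succAbove f = e j := fun j =>
        Fin.exists_succAbove_eq fun h => he.2 ⟨j, h⟩
      choose f hf using hex
      have hmono : StrictMono f := by
        intro j j' hj
        rw [← (Fin.strictMono_succAbove i).lt_iff_lt, hf, hf]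
        exact e.strictMono hj
      refine ⟨OrderEmbedding.ofStrictMono f hmono, ?_, RelEmbedding.ext hf⟩
      obtain ⟨π, hπ, hiso⟩ := he.1
      refine ⟨π, hπ, ?_⟩
      simpa only [OrderEmbedding.coe_ofStrictMono, hf] using hiso
    rw [← Set.ncard_coe_finset]
    exact (Set.ncard_le_ncard hsub (Set.toFinite _)).trans (Set.ncard_image_le (Set.toFinite _))
  refine le_trans (le_of_eq ?_) (Finset.sum_le_sum fun i _ => h1 i)
  have h2 := Finset.sum_card_bipartiteAbove_eq_sum_card_bipartiteBelow
    (s := O) (t := (Finset.univ : Finset (Fin (n + 1))))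
    (fun (e : Fin m ↪o Fin (n + 1)) i => i ∉ Set.range e)
  simp only [Finset.bipartiteAbove, Finset.bipartiteBelow] at h2
  rw [← h2]
  have h3 : ∀ e ∈ O,
      (Finset.univ.filter fun i => i ∉ Set.range (e : Fin m → Fin (n + 1))).card = n + 1 - m := by
    intro e _
    have : (Finset.univ.filter fun i => i ∉ Set.range (e : Fin m → Fin (n + 1))) =
        (Finset.univ.map e.toEmbedding)ᶜ := by
      ext i
      simp
    rw [this, Finset.card_compl, Finset.card_map, Finset.card_univ, Fintype.card_fin,
      Fintype.card_fin]
  rw [Finset.sum_congr rfl h3, Finset.sum_const, smul_eq_mul]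
  congr 1
  rw [hO, ← Set.ncard_coe_finset, Set.coe_toFinset]
  rfl

theorem maxOccurrences_eq_zero_or (k n : ℕ) :
    maxOccurrences P k n = 0 ∨ ∃ σ : Fin n → Fin k, maxOccurrences P k n = occurrences P σ := by
  rcases (Finset.univ : Finset (Fin n → Fin k)).eq_empty_or_nonempty with he | hne
  · left
    rw [maxOccurrences, he, Finset.sup_empty]
    rfl
  · obtain ⟨σ, -, hσ⟩ := Finset.exists_mem_eq_sup _ hne fun σ : Fin n → Fin k => occurrences P σ
    exact Or.inr ⟨σ, hσ⟩

theorem maxOccurrences_succ_mul_le (k n : ℕ) :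
    maxOccurrences P k (n + 1) * (n + 1 - m) ≤ (n + 1) * maxOccurrences P k n := by
  obtain h0 | ⟨σ, hσ⟩ := maxOccurrences_eq_zero_or P k (n + 1)
  · simp [h0]
  · rw [hσ]
    refine (occurrences_mul_le_sum P σ).trans ?_
    refine (Finset.sum_le_card_nsmul _ _ _ fun i _ => occurrences_le_maxOccurrences P _).trans ?_
    simp

theorem maxDensity_succ_le {n : ℕ} (k : ℕ) (hn : m ≤ n) :
    maxDensity P k (n + 1) ≤ maxDensity P k n := by
  unfold maxDensity
  have hc : (0 : ℝ) < n.choose m := by exact_mod_cast Nat.choose_pos hn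
  have hc' : (0 : ℝ) < (n + 1).choose m := by exact_mod_cast Nat.choose_pos (by omega)
  rw [div_le_div_iff₀ hc' hc]
  have h1 := Nat.choose_mul_succ_eq n m
  have h2 := maxOccurrences_succ_mul_le P k n
  have h3 : maxOccurrences P k (n + 1) * n.choose m * (n + 1) ≤
      maxOccurrences P k n * (n + 1).choose m * (n + 1) := by
    calc _ = maxOccurrences P k (n + 1) * (n + 1 - m) * (n + 1).choose m := by
          rw [mul_assoc, h1]; ring
      _ ≤ (n + 1) * maxOccurrences P k n * (n + 1).choose m := Nat.mul_le_mul_right _ h2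
      _ = _ := by ring
  exact_mod_cast Nat.le_of_mul_le_mul_right h3 n.succ_pos

/-- Replacing every letter of a word by `N` copies of it multiplies the number of occurrences by
at least `N ^ m`. -/
theorem occurrences_mul_pow_le {k n : ℕ} (N : ℕ) (τ : Fin n → Fin k) :
    occurrences P τ * N ^ m ≤ maxOccurrences P k (n * N) := by
  refine le_trans ?_ (occurrences_le_maxOccurrences P
    -- `finProdFinEquiv` places the `N` copies of a letter in consecutive positions, so one copy may
    -- be chosen freely for each letter of an occurrence.
    fun i => τ (finProdFinEquiv.symm i).1)
  let F : occurrenceSet P τ × (Fin m → Fin N) → (Fin m ↪o Fin (n * N)) := fun w =>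
    OrderEmbedding.ofStrictMono (fun i => finProdFinEquiv (w.1.1 i, w.2 i)) (by
      intro i j hij
      have h1 : ((w.1.1 i : ℕ) + 1) ≤ w.1.1 j := w.1.1.strictMono hij
      have h2 := Nat.mul_le_mul_left N h1
      have h3 := (w.2 i).2
      simp only [Fin.lt_def, finProdFinEquiv_apply_val]
      rw [mul_add] at h2
      omega)
  have hval : ∀ w i, F w i = finProdFinEquiv (w.1.1 i, w.2 i) := fun w i => rfl
  have hF : Function.Injective F := by
    rintro ⟨⟨e, he⟩, c⟩ ⟨⟨e', he'⟩, c'⟩ heq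
    have h1 : ∀ i, (e i, c i) = (e' i, c' i) := fun i =>
      finProdFinEquiv.injective (by rw [← hval (⟨e, he⟩, c), heq, hval])
    have h2 : e = e' := RelEmbedding.ext fun i => congrArg Prod.fst (h1 i)
    have h3 : c = c' := funext fun i => congrArg Prod.snd (h1 i)
    subst h2 h3
    rfl
  have hmem : ∀ w, F w ∈ occurrenceSet P (fun i => τ (finProdFinEquiv.symm i).1) := by
    rintro ⟨⟨e, π, hπ, hiso⟩, c⟩
    refine ⟨π, hπ, ?_⟩
    simpa only [hval, Equiv.symm_apply_apply] using hiso
  calc occurrences P τ * N ^ m = Nat.card (occurrenceSet P τ × (Fin m → Fin N)) := by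
        rw [Nat.card_prod, Nat.card_coe_set_eq]
        simp [occurrences, occurrenceSet]
    _ = (Set.range F).ncard := by
        rw [← Set.image_univ, Set.ncard_image_of_injective _ hF, Set.ncard_univ]
    _ ≤ _ := Set.ncard_le_ncard (Set.range_subset_iff.2 hmem) (Set.toFinite _)

theorem isPackingDensity_of_bounds {d : ℝ} {U L : ℕ → ℝ}
    (hU : ∀ k n, 0 < n → maxDensity P k n ≤ U n) (hUd : Tendsto U atTop (𝓝 d))
    (hL : ∀ k N, 0 < k → m ≤ N → L k ≤ maxDensity P k (k * N)) (hLd : Tendsto L atTop (𝓝 d)) :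
    IsPackingDensity P d := by
  have hnn : ∀ k n, 0 ≤ maxDensity P k n := fun k n => by unfold maxDensity; positivity
  have hf : ∀ n, Tendsto (fun k => maxDensity P k n) atTop (𝓝 (⨆ k, maxDensity P k n)) := by
    intro n
    refine tendsto_atTop_ciSup ?_ ⟨(Nat.card (Fin m ↪o Fin n) : ℝ) / n.choose m, ?_⟩
    · intro k k' hk
      simp only [maxDensity]
      gcongr
      exact maxOccurrences_mono P n hk
    · rintro _ ⟨k, rfl⟩
      simp only [maxDensity]
      gcongr
      exact maxOccurrences_le_card P k n
  have hbdd : ∀ k, BddBelow (Set.range fun n => maxDensity P k (n + m)) := fun k =>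
    ⟨0, by rintro _ ⟨n, rfl⟩; exact hnn _ _⟩
  have hanti : ∀ k, Antitone fun n => maxDensity P k (n + m) := fun k =>
    antitone_nat_of_succ_le fun n => by
      rw [Nat.add_right_comm]
      exact maxDensity_succ_le P k (by omega)
  have hg : ∀ k, Tendsto (fun n => maxDensity P k n) atTop
      (𝓝 (⨅ n, maxDensity P k (n + m))) := fun k =>
    (tendsto_add_atTop_iff_nat m).1 (tendsto_atTop_ciInf (hanti k) (hbdd k))
  have hgd : Tendsto (fun k => ⨅ n, maxDensity P k (n + m)) atTop (𝓝 d) := by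
    refine tendsto_of_tendsto_of_tendsto_of_le_of_le' hLd tendsto_const_nhds ?_ ?_
    · filter_upwards [eventually_gt_atTop 0] with k hk
      -- The limit in `n` exists, so it may be read along the multiples of `k`, where the lower
      -- bound lives.
      refine ge_of_tendsto ((hg k).comp (tendsto_id.const_mul_atTop' hk)) ?_
      filter_upwards [eventually_ge_atTop m] with N hN
      exact hL k N hk hN
    · refine Eventually.of_forall fun k => le_of_tendsto_of_tendsto (hg k) hUd ?_
      filter_upwards [eventually_gt_atTop 0] with n hn
      exact hU k n hn
  refine ⟨⟨_, hf, ?_⟩, ⟨_, hg, hgd⟩⟩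
  refine tendsto_of_tendsto_of_tendsto_of_le_of_le' tendsto_const_nhds hUd ?_ ?_
  -- For `n ≥ m` the limit in `n` lies below the density at `n`, for each `k`; letting `k → ∞` gives
  -- `d` as a lower bound for the other inner limit.
  · filter_upwards [eventually_ge_atTop m] with n hn
    refine le_of_tendsto_of_tendsto' hgd (hf n) fun k => ?_
    have := ciInf_le (hbdd k) (n - m)
    rwa [Nat.sub_add_cancel hn] at this
  · filter_upwards [eventually_gt_atTop 0] with n hn
    exact ciSup_le fun k => hU k n hn

end Words

/-! ### Asymptotics of binomials and conclusion -/

theorem tendsto_pow_div_choose (m : ℕ) :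
    Tendsto (fun n : ℕ => (n : ℝ) ^ m / n.choose m) atTop (𝓝 m.factorial) := by
  have h := isEquivalent_choose m
  have h1 : Tendsto ((fun n : ℕ => (n ^ m / m.factorial : ℝ)) / fun n : ℕ => (n.choose m : ℝ))
      atTop (𝓝 1) := by
    refine (Asymptotics.isEquivalent_iff_tendsto_one ?_).1 h.symm
    filter_upwards [eventually_ge_atTop m] with n hn
    exact_mod_cast (Nat.choose_pos hn).ne'
  have h2 := h1.const_mul (m.factorial : ℝ)
  rw [mul_one] at h2
  refine h2.congr fun n => ?_
  have : (m.factorial : ℝ) ≠ 0 := by exact_mod_cast m.factorial_ne_zero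
  simp only [Pi.div_apply]
  field_simp

/-- A squeeze: `a! * (r.choose a)` lies between `(r + 1 - a)^a` and `r^a`. -/
theorem tendsto_choose_div_pow {r : ℕ → ℕ} {t : ℝ} (a : ℕ)
    (hr : Tendsto (fun k : ℕ => (r k : ℝ) / k) atTop (𝓝 t)) :
    Tendsto (fun k : ℕ => ((r k).choose a : ℝ) / (k : ℝ) ^ a) atTop (𝓝 (t ^ a / a.factorial)) := by
  have hfac : (0 : ℝ) < a.factorial := by exact_mod_cast a.factorial_pos
  have hconst : ∀ c : ℝ, Tendsto (fun k : ℕ => c / (k : ℝ)) atTop (𝓝 0) :=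
    tendsto_const_div_atTop_nhds_zero_nat
  have hlow : Tendsto (fun k : ℕ => ((r k + 1 - a : ℕ) : ℝ) / k) atTop (𝓝 t) := by
    have h1 := hr.sub (hconst a)
    have h2 := hr.add (hconst 1)
    rw [sub_zero] at h1
    rw [add_zero] at h2
    refine tendsto_of_tendsto_of_tendsto_of_le_of_le h1 h2 (fun k => ?_) (fun k => ?_)
    · dsimp only
      rw [← sub_div]
      gcongr
      rw [sub_le_iff_le_add]
      exact_mod_cast (by omega : r k ≤ r k + 1 - a + a)
    · dsimp only
      rw [← add_div]
      gcongr
      exact_mod_cast (by omega : r k + 1 - a ≤ r k + 1)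
  have hch : ∀ n : ℕ, (a.factorial : ℝ) * n.choose a = n.descFactorial a := fun n => by
    exact_mod_cast (Nat.descFactorial_eq_factorial_mul_choose n a).symm
  refine tendsto_of_tendsto_of_tendsto_of_le_of_le ((hlow.pow a).div_const _)
    ((hr.pow a).div_const _) (fun k => ?_) (fun k => ?_)
  · dsimp only
    rw [div_pow, div_right_comm]
    gcongr
    rw [div_le_iff₀ hfac, mul_comm, hch]
    exact_mod_cast Nat.pow_sub_le_descFactorial (r k) a
  · dsimp only
    rw [div_pow, div_right_comm]
    gcongr
    rw [le_div_iff₀ hfac, mul_comm, hch]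
    exact_mod_cast Nat.descFactorial_le_pow (r k) a

theorem mainTheorem10 (a b : ℕ) (ha : 2 ≤ a) (hab : a < b) :
    IsPackingDensity
        ({layeredPerm (twoParts (a + b) a b (by omega) (by omega) rfl),
          layeredPerm (twoParts (a + b) b a (by omega) (by omega) (Nat.add_comm b a))} :
          Set (Fin (a + b) → Fin (a + b)))
        (((a + b).choose a : ℝ) *
          sSup ((fun x : ℝ => x ^ a * (1 - x) ^ b + x ^ b * (1 - x) ^ a) '' Set.Icc 0 1)) ∧
      ((b - a = 1 ∨ b - a = 2) →
        IsMaxOn (fun x : ℝ => x ^ a * (1 - x) ^ b + x ^ b * (1 - x) ^ a) (Set.Icc 0 1) (1 / 2)) := by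
  refine ⟨?_, isMaxOn_half ha hab⟩
  obtain ⟨t, ht, htmax⟩ := (isCompact_Icc (a := (0 : ℝ)) (b := 1)).exists_isMaxOn
    (Set.nonempty_Icc.2 zero_le_one)
    (f := fun x : ℝ => x ^ a * (1 - x) ^ b + x ^ b * (1 - x) ^ a) (by fun_prop)
  have hsup : sSup ((fun x : ℝ => x ^ a * (1 - x) ^ b + x ^ b * (1 - x) ^ a) '' Set.Icc 0 1) =
      t ^ a * (1 - t) ^ b + t ^ b * (1 - t) ^ a :=
    IsGreatest.csSup_eq ⟨⟨t, ht, rfl⟩, by rintro _ ⟨x, hx, rfl⟩; exact htmax hx⟩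
  rw [hsup]
  set M := t ^ a * (1 - t) ^ b + t ^ b * (1 - t) ^ a with hM
  have hM0 : 0 ≤ M := by
    have h0 := ht.1
    have h1 := sub_nonneg.2 ht.2
    positivity
  have hfa : (0 : ℝ) < a.factorial := by exact_mod_cast a.factorial_pos
  have hfb : (0 : ℝ) < b.factorial := by exact_mod_cast b.factorial_pos
  have hfm : ((a + b).choose a : ℝ) * M = M / (a.factorial * b.factorial) * (a + b).factorial := by
    have := Nat.add_choose_mul_factorial_mul_factorial a b
    rw [← this, ← Nat.choose_symm_add]
    push_cast
    field_simp
  rw [hfm]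
  refine isPackingDensity_of_bounds _
    (U := fun n => M / (a.factorial * b.factorial) * ((n : ℝ) ^ (a + b) / n.choose (a + b)))
    (L := fun k => (a + b).factorial *
      ((⌊t * k⌋₊.choose a / (k : ℝ) ^ a) * ((k - ⌊t * k⌋₊).choose b / (k : ℝ) ^ b) +
        (⌊t * k⌋₊.choose b / (k : ℝ) ^ b) * ((k - ⌊t * k⌋₊).choose a / (k : ℝ) ^ a)))
    ?_ ((tendsto_pow_div_choose (a + b)).const_mul _) ?_ ?_
  · intro k n hn
    rw [maxDensity, mul_div_assoc']
    gcongr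
    rw [div_mul_eq_mul_div]
    rw [le_div_iff₀ (by positivity)]
    obtain h0 | ⟨σ, hσ⟩ := maxOccurrences_eq_zero_or
      ({layeredPerm (twoParts (a + b) a b (by omega) (by omega) rfl),
        layeredPerm (twoParts (a + b) b a (by omega) (by omega) (Nat.add_comm b a))} :
        Set (Fin (a + b) → Fin (a + b))) k n
    · rw [h0, Nat.cast_zero, zero_mul]
      positivity
    · rw [hσ, occurrences_pair]
      exact ncard_layeredOccurrences_le ha hab hn (fun x hx => htmax hx) σ
  · intro k N hk hN
    have hle : ⌊t * k⌋₊ ≤ k := by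
      refine Nat.floor_le_of_le ?_
      have : (0 : ℝ) ≤ k := by positivity
      nlinarith [ht.2]
    have h1 := (Nat.mul_le_mul_right (N ^ (a + b)) (choose_mul_choose_add_le_occurrences
      (by omega) hab (Nat.add_comm b a) ⌊t * k⌋₊ (k - ⌊t * k⌋₊))).trans
      (occurrences_mul_pow_le _ N _)
    rw [Nat.add_sub_cancel' hle] at h1
    have hkN : a + b ≤ k * N := hN.trans (Nat.le_mul_of_pos_left N hk)
    have hc : (0 : ℝ) < (k * N).choose (a + b) := by exact_mod_cast Nat.choose_pos hkN
    -- This makes the bound `L k` independent of `N`: the factor `N^(a+b)` gained by the blow-up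
    -- outweighs the binomial in the denominator.
    have h2 : ((k * N).choose (a + b) : ℝ) * (a + b).factorial ≤ (k : ℝ) ^ (a + b) * N ^ (a + b) := by
      rw [← mul_pow, mul_comm, ← Nat.cast_mul, ← Nat.cast_mul,
        ← Nat.descFactorial_eq_factorial_mul_choose]
      exact_mod_cast Nat.descFactorial_le_pow (k * N) (a + b)
    have hk0 : (0 : ℝ) < k := by exact_mod_cast hk
    rw [maxDensity, le_div_iff₀ hc]
    refine le_trans ?_ (Nat.cast_le.2 h1)
    push_cast
    rw [div_mul_div_comm, div_mul_div_comm, ← pow_add, ← pow_add, Nat.add_comm b a,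
      ← add_div]
    set X : ℝ := (⌊t * k⌋₊.choose a : ℝ) * (k - ⌊t * k⌋₊).choose b +
      ⌊t * k⌋₊.choose b * (k - ⌊t * k⌋₊).choose a with hX
    have hX0 : 0 ≤ X := by positivity
    calc (a + b).factorial * (X / (k : ℝ) ^ (a + b)) * (k * N).choose (a + b) =
          X / (k : ℝ) ^ (a + b) * ((k * N).choose (a + b) * (a + b).factorial) := by ring
      _ ≤ X / (k : ℝ) ^ (a + b) * ((k : ℝ) ^ (a + b) * N ^ (a + b)) := by gcongr
      _ = X * N ^ (a + b) := by field_simp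
  · have hr : Tendsto (fun k : ℕ => (⌊t * k⌋₊ : ℝ) / k) atTop (𝓝 t) :=
      (tendsto_nat_floor_mul_div_atTop ht.1).comp tendsto_natCast_atTop_atTop
    have hs : Tendsto (fun k : ℕ => ((k - ⌊t * k⌋₊ : ℕ) : ℝ) / k) atTop (𝓝 (1 - t)) := by
      refine (hr.const_sub 1).congr' ?_
      filter_upwards [eventually_gt_atTop 0] with k hk
      have hle : ⌊t * k⌋₊ ≤ k := by
        refine Nat.floor_le_of_le ?_
        have : (0 : ℝ) ≤ k := by positivity
        nlinarith [ht.2]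
      have : (k : ℝ) ≠ 0 := by positivity
      rw [Nat.cast_sub hle]
      field_simp
    have h := (((tendsto_choose_div_pow a hr).mul (tendsto_choose_div_pow b hs)).add
      ((tendsto_choose_div_pow b hr).mul (tendsto_choose_div_pow a hs))).const_mul
      ((a + b).factorial : ℝ)
    convert h using 2
    rw [hM]
    field_simp
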